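/- **Setup.** Let $d,n,m\ge 0$ be integers. Consider $n$ points and $m$ views, let $E(\Gamma)\subseteq[1,n]\times[1,m]$ be the set of pairs $(k,i)$ such that the point $k$ lies in the view $i$, and for $(k,i)\in E(\Gamma)$ let $\mathbf x_{k,i}\in\mathbb R^d$ be the local coordinates of the point $k$ in the view $i$. Assume that the bipartite graph $\Gamma$ of points and views is connected. Let $\mathcal L_\Gamma$ be the combinatorial Laplacian of $\Gamma$, $\mathcal L_\Gamma^\dagger$ its Moore–Penrose pseudoinverse, and let $$\mathbf B=\sum_{(k,i)\in E(\Gamma)}(\mathbf e^m_i\otimes \mathbf I_d)\,\mathbf x_{k,i}\,(\mathbf e^{n+m}_k-\mathbf e^{n+m}_{n+i})^T,\qquad \mathbf D=\text{block-diag}\Big(\sum_{k:(k,i)\in E(\Gamma)}\mathbf x_{k,i}\mathbf x_{k,i}^T\Big)_{i=1}^m,\qquad \mathbf C=\mathbf D-\mathbf B\mathcal L_\Gamma^\dagger\mathbf B^T .$$ For $\mathbf S=[\mathbf S_i]_1^m\in\mathbb O(d)^m$ (an $md\times d$ matrix) let $F(\mathbf S)=\mathrm{Tr}(\mathbf S^T\mathbf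 C\mathbf S)$, which is the minimum of $\sum_{(k,i)\in E(\Gamma)}\|\mathbf S_i^T\mathbf x_{k,i}+\mathbf t_i-\mathbf x_k\|^2$ over all $\mathbf t_i,\mathbf x_k\in\mathbb R^d$. $\mathbf S$ is a *perfect alignment* if $F(\mathbf S)=0$. Its *realization* is the $d\times n$ matrix $\Theta(\mathbf S)=\mathbf S^T\mathbf B\mathcal L_\Gamma^\dagger(:,1{:}n)(\mathbf I_n-\tfrac1n\mathbf 1_n\mathbf 1_n^T)$, whose $k$-th column is the aligned position of the point $k$. Let $\pi:\mathbb O(d)^m\to\mathbb O(d)^m/_\sim$ be the quotient by $\mathbf S\sim\mathbf S\mathbf Q$, $\mathbf Q\in\mathbb O(d)$, with the quotient Riemannian metric of $g(\mathbf Z,\mathbf W)=\sum_i\mathrm{Tr}(\mathbf Z_i^T\mathbf W_i)$, and let $\widetilde F$ be the function induced by $F$ on the quotient. An element of the quotient is *non-degenerate* if it is a critical point of $\widetilde F$ at which the Riemannian Hessian of $\widetilde F$ is nonsingular. For a perfect alignment $\mathbf S$, the realization $\Theta(\mathbf S)$ is *locally rigid* if there is $\epsilon>0$ such that every perfect alignment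 $\mathbf O$ with $\|\Theta(\mathbf O)-\Theta(\mathbf S)\|_F<\epsilon$ satisfies $\Theta(\mathbf O)=\Theta(\mathbf S\mathbf Q)$ for some $\mathbf Q\in\mathbb O(d)$. **The graphs.** Let $\mathbf S$ be a perfect alignment. For sets $A,B$ of views let $\mathbf B(\mathbf S)_{A,B}$ be the matrix whose columns are the aligned coordinates (columns of $\Theta(\mathbf S)$) of the $n'$ points that lie both in some view of $A$ and in some view of $B$, and let $\overline{\mathbf B(\mathbf S)}_{A,B}=\mathbf B(\mathbf S)_{A,B}(\mathbf I_{n'}-\tfrac1{n'}\mathbf 1_{n'}\mathbf 1_{n'}^T)$ (of rank $0$ if $n'=0$). Let $\mathbb G$ be the graph on the $m$ views in which two distinct views $i,j$ are adjacent iff $\mathrm{rank}\,\overline{\mathbf B(\mathbf S)}_{\{i\},\{j\}}\ge d-1$. Merge the views of each connected component of $\mathbb G$ into one view, and form in the same way the graph on the merged views, with distinct $A,B$ adjacent iff $\mathrm{rank}\,\overline{\mathbf B(\mathbf S)}_{A,B}\ge d-1$; repeat this until the graph has no edges. The final graph is the reduced graph $\mathbb G^*(\mathbf S)$, and $|\mathbb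 G^*(\mathbf S)|$ is its number of vertices. **Theorem.** Let $\mathbf S$ be a perfect alignment. If $|\mathbb G^*(\mathbf S)|=1$, then $\pi(\mathbf S)$ is non-degenerate, and the realization $\Theta(\mathbf S)$ is locally rigid. -/

import Mathlib

noncomputable section

namespace RigidAlignment

open Matrix

/-! ### Views, alignments and the alignment error -/

/-- `m` local views of `n` points in dimension `d`.  `mem k i` says that the point `k` lies in the
view `i`, that is, `(k, i) ∈ E(Γ)`; in that case `x k i` is the vector `x_{k,i}` of local coordinates
of the point `k` in the view `i`.  The values `x k i` with `¬ mem k i` are never used. -/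
structure ViewSystem (d n m : ℕ) where
  mem : Fin n → Fin m → Prop
  x : Fin n → Fin m → Fin d → ℝ

/-- Elements `S = (S_1, …, S_m)` of `𝕆(d)^m`. -/
abbrev Alignment (d m : ℕ) : Type := Fin m → Matrix.orthogonalGroup (Fin d) ℝ

/-- `S Q = (S_1 Q, …, S_m Q)` for `Q ∈ 𝕆(d)`. -/
def Alignment.rightMul {d m : ℕ} (S : Alignment d m) (Q : Matrix.orthogonalGroup (Fin d) ℝ) :
    Alignment d m :=
  fun i => S i * Q

/-- The block column `[S_i]_1^m`, an `md × d` matrix. -/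
def Alignment.stack {d m : ℕ} (S : Alignment d m) : Matrix (Fin m × Fin d) (Fin d) ℝ :=
  Matrix.of fun p b => (S p.1 : Matrix (Fin d) (Fin d) ℝ) p.2 b

/-- The Moore-Penrose pseudoinverse of a real symmetric matrix: if `A = U diag(λ) Uᵀ`, it is
`U diag(λ⁻¹) Uᵀ` with `0⁻¹ = 0`. -/
def pinv {ι : Type*} [Fintype ι] [DecidableEq ι] {A : Matrix ι ι ℝ} (hA : A.IsHermitian) :
    Matrix ι ι ℝ :=
  hA.cfc fun t => t⁻¹

/-- `pinv` satisfies the four Penrose equations. -/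
theorem pinv_spec {ι : Type*} [Fintype ι] [DecidableEq ι] {A : Matrix ι ι ℝ}
    (hA : A.IsHermitian) :
    A * pinv hA * A = A ∧ pinv hA * A * pinv hA = pinv hA ∧
      (A * pinv hA)ᵀ = A * pinv hA ∧ (pinv hA * A)ᵀ = pinv hA * A := by
  have hs : ∀ f : ℝ → ℝ, (hA.cfc f)ᵀ = hA.cfc f := by
    intro f
    rw [← hA.cfc_eq, ← Matrix.conjTranspose_eq_transpose_of_trivial]
    exact cfc_predicate (R := ℝ) (p := IsSelfAdjoint) f A
  have hm : ∀ f g : ℝ → ℝ, hA.cfc f * hA.cfc g = hA.cfc fun t => f t * g t := by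
    intro f g
    simp only [Matrix.IsHermitian.cfc, ← map_mul, Matrix.diagonal_mul_diagonal]
    rfl
  have hid : A = hA.cfc (fun t => t) := hA.spectral_theorem
  have h1 : A * pinv hA = hA.cfc fun t => t * t⁻¹ := (congrArg (· * pinv hA) hid).trans (hm _ _)
  have h2 : pinv hA * A = hA.cfc fun t => t⁻¹ * t := (congrArg (pinv hA * ·) hid).trans (hm _ _)
  refine ⟨?_, ?_, ?_, ?_⟩
  · rw [h1]
    refine (congrArg (hA.cfc (fun t => t * t⁻¹) * ·) hid).trans ((hm _ _).trans ?_)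
    simp only [mul_inv_mul_cancel]
    exact hid.symm
  · rw [h2, pinv, hm]
    congr 1
    funext t
    by_cases ht : t = 0 <;> simp [ht]
  · rw [h1, hs]
  · rw [h2, hs]

namespace ViewSystem

variable {d n m : ℕ} (V : ViewSystem d n m)

/-- The bipartite graph `Γ` of points and views. -/
def graph : SimpleGraph (Fin n ⊕ Fin m) where
  Adj
    | .inl k, .inr i => V.mem k i
    | .inr i, .inl k => V.mem k i
    | _, _ => False
  symm := ⟨by rintro (k | i) (l | j) h <;> exact h⟩
  loopless := ⟨by rintro (k | i) h <;> exact h⟩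

open Classical in
/-- The combinatorial Laplacian `𝓛_Γ`. -/
def lap : Matrix (Fin n ⊕ Fin m) (Fin n ⊕ Fin m) ℝ := V.graph.lapMatrix ℝ

theorem lap_isHermitian : V.lap.IsHermitian := by
  classical
  exact SimpleGraph.isHermitian_lapMatrix _ V.graph

/-- `𝓛_Γ^†`. -/
def lapPinv : Matrix (Fin n ⊕ Fin m) (Fin n ⊕ Fin m) ℝ := pinv V.lap_isHermitian

open Classical in
/-- The `md × (n + m)` matrix `B = ∑_{(k,i) ∈ E(Γ)} (e_i ⊗ I_d) x_{k,i} (e_k - e_{n+i})ᵀ`. -/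
def B : Matrix (Fin m × Fin d) (Fin n ⊕ Fin m) ℝ :=
  Matrix.of fun p c =>
    match c with
    | .inl k => if V.mem k p.1 then V.x k p.1 p.2 else 0
    | .inr j => if j = p.1 then -∑ k, (if V.mem k p.1 then V.x k p.1 p.2 else 0) else 0

open Classical in
/-- The block diagonal matrix `D` with the blocks `D_i = ∑_{k : (k,i) ∈ E(Γ)} x_{k,i} x_{k,i}ᵀ`. -/
def D : Matrix (Fin m × Fin d) (Fin m × Fin d) ℝ :=
  Matrix.of fun p q =>
    if p.1 = q.1 then ∑ k, (if V.mem k p.1 then V.x k p.1 p.2 * V.x k p.1 q.2 else 0) else 0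

/-- `C = D - B 𝓛_Γ^† Bᵀ`. -/
def C : Matrix (Fin m × Fin d) (Fin m × Fin d) ℝ := V.D - V.B * V.lapPinv * V.Bᵀ

/-- The alignment error `F(S) = Tr(Sᵀ C S)`, which is the minimum over the translations `t_i` and
the consensus points `x_k` of `∑_{(k,i) ∈ E(Γ)} ‖S_iᵀ x_{k,i} + t_i - x_k‖²`. -/
def F (S : Alignment d m) : ℝ := (S.stackᵀ * V.C * S.stack).trace

/-- `S` is a perfect alignment if its alignment error vanishes. -/
def IsPerfect (S : Alignment d m) : Prop := V.F S = 0

/-- The realization `Θ(S) = Sᵀ B 𝓛_Γ^†(:, 1:n) (I_n - n⁻¹ 1_n 1_nᵀ)`, a `d × n` matrix whose `k`-th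
column is the optimal position of the `k`-th point, the configuration being centred at `0`. -/
def realization (S : Alignment d m) : Matrix (Fin d) (Fin n) ℝ :=
  (S.stackᵀ * V.B * V.lapPinv).submatrix id Sum.inl *
    (1 - (n : ℝ)⁻¹ • Matrix.of fun _ _ => 1 : Matrix (Fin n) (Fin n) ℝ)

open Classical in
/-- The incidence matrix of `Γ`, with the columns `e_k - e_{n+i}` for `(k,i) ∈ E(Γ)`. -/
def incidence : Matrix (Fin n ⊕ Fin m) (Fin n × Fin m) ℝ :=
  Matrix.of fun c e =>
    if V.mem e.1 e.2 then (if c = .inl e.1 then 1 else 0) - (if c = .inr e.2 then 1 else 0) else 0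

open Classical in
/-- The matrix with the columns `S_iᵀ x_{k,i}` for `(k,i) ∈ E(Γ)`. -/
def rotated (S : Alignment d m) : Matrix (Fin d) (Fin n × Fin m) ℝ :=
  Matrix.of fun a e =>
    if V.mem e.1 e.2 then ((S e.2 : Matrix (Fin d) (Fin d) ℝ)ᵀ *ᵥ V.x e.1 e.2) a else 0

theorem lap_eq : V.lap = V.incidence * V.incidenceᵀ := by
  classical
  have hdk : ∀ k, ((V.graph.degree (.inl k) : ℕ) : ℝ) = ∑ i, if V.mem k i then 1 else 0 := by
    intro k
    rw [SimpleGraph.degree_eq_sum_if_adj, Fintype.sum_sum_type,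
      Finset.sum_eq_zero fun l _ => if_neg (fun h => h : ¬V.graph.Adj (.inl k) (.inl l)), zero_add]
    exact Finset.sum_congr rfl fun i _ => if_congr Iff.rfl rfl rfl
  have hdi : ∀ i, ((V.graph.degree (.inr i) : ℕ) : ℝ) = ∑ k, if V.mem k i then 1 else 0 := by
    intro i
    rw [SimpleGraph.degree_eq_sum_if_adj, Fintype.sum_sum_type, add_comm,
      Finset.sum_eq_zero fun l _ => if_neg (fun h => h : ¬V.graph.Adj (.inr i) (.inr l)), zero_add]
    exact Finset.sum_congr rfl fun k _ => if_congr Iff.rfl rfl rfl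
  ext (k | i) (l | j)
  · by_cases h : k = l
    · subst h
      simp only [lap, SimpleGraph.lapMatrix, SimpleGraph.degMatrix, Matrix.sub_apply,
        Matrix.diagonal_apply_eq, SimpleGraph.adjMatrix_apply, Matrix.mul_apply,
        Matrix.transpose_apply, incidence, Matrix.of_apply, Fintype.sum_prod_type, hdk]
      rw [Finset.sum_eq_single k]
      · rw [if_neg (SimpleGraph.irrefl _), sub_zero]
        refine Finset.sum_congr rfl fun i _ => ?_
        by_cases hm : V.mem k i <;> simp [hm]
      · intro b _ hb
        simp [hb.symm]
      · simp
    · simp only [lap, SimpleGraph.lapMatrix, SimpleGraph.degMatrix, Matrix.sub_apply,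
        SimpleGraph.adjMatrix_apply, Matrix.mul_apply,
        Matrix.transpose_apply, incidence, Matrix.of_apply, Fintype.sum_prod_type]
      rw [Finset.sum_eq_zero]
      · simp [graph, h]
      · intro b _
        refine Finset.sum_eq_zero fun c _ => ?_
        by_cases hb : k = b
        · subst hb
          simp [Ne.symm h]
        · simp [hb]
  · simp only [lap, SimpleGraph.lapMatrix, SimpleGraph.degMatrix, Matrix.sub_apply,
      SimpleGraph.adjMatrix_apply, Matrix.mul_apply,
      Matrix.transpose_apply, incidence, Matrix.of_apply, Fintype.sum_prod_type]
    rw [Finset.sum_eq_single k, Finset.sum_eq_single j]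
    · by_cases h : V.mem k j <;> simp [graph, h]
    · intro b _ hb
      simp [hb.symm]
    · simp
    · intro b _ hb
      simp [hb.symm]
    · simp
  · simp only [lap, SimpleGraph.lapMatrix, SimpleGraph.degMatrix, Matrix.sub_apply,
      SimpleGraph.adjMatrix_apply, Matrix.mul_apply,
      Matrix.transpose_apply, incidence, Matrix.of_apply, Fintype.sum_prod_type]
    rw [Finset.sum_eq_single l, Finset.sum_eq_single i]
    · by_cases h : V.mem l i <;> simp [graph, h]
    · intro b _ hb
      simp [hb.symm]
    · simp
    · intro b _ hb
      simp [hb.symm]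
    · simp
  · by_cases h : i = j
    · subst h
      simp only [lap, SimpleGraph.lapMatrix, SimpleGraph.degMatrix, Matrix.sub_apply,
        Matrix.diagonal_apply_eq, SimpleGraph.adjMatrix_apply, Matrix.mul_apply,
        Matrix.transpose_apply, incidence, Matrix.of_apply, Fintype.sum_prod_type, hdi]
      rw [if_neg (SimpleGraph.irrefl _), sub_zero]
      refine Finset.sum_congr rfl fun k _ => ?_
      rw [Finset.sum_eq_single i]
      · by_cases hm : V.mem k i <;> simp [hm]
      · intro b _ hb
        simp [hb.symm]
      · simp
    · simp only [lap, SimpleGraph.lapMatrix, SimpleGraph.degMatrix, Matrix.sub_apply,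
        SimpleGraph.adjMatrix_apply, Matrix.mul_apply,
        Matrix.transpose_apply, incidence, Matrix.of_apply, Fintype.sum_prod_type]
      rw [Finset.sum_eq_zero]
      · simp [graph, h]
      · intro b _
        refine Finset.sum_eq_zero fun c _ => ?_
        by_cases hb : i = c
        · subst hb
          simp [Ne.symm h]
        · simp [hb]

theorem stack_mul_B (S : Alignment d m) : S.stackᵀ * V.B = V.rotated S * V.incidenceᵀ := by
  classical
  ext a (k | j)
  · simp only [Matrix.mul_apply, Matrix.transpose_apply, Fintype.sum_prod_type, B, incidence,
      rotated, Matrix.of_apply, Alignment.stack]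
    rw [Finset.sum_eq_single (M := ℝ) (s := (Finset.univ : Finset (Fin n))) k]
    · refine Finset.sum_congr rfl fun i _ => ?_
      by_cases h : V.mem k i <;> simp [h, Matrix.mulVec, dotProduct]
    · intro b _ hb
      simp [hb.symm]
    · simp
  · simp only [Matrix.mul_apply, Matrix.transpose_apply, Fintype.sum_prod_type, B, incidence,
      rotated, Matrix.of_apply, Alignment.stack]
    rw [Finset.sum_comm (s := (Finset.univ : Finset (Fin n))),
      Finset.sum_eq_single j, Finset.sum_eq_single (M := ℝ) (s := (Finset.univ : Finset (Fin m))) j]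
    · simp only [if_true, mul_neg, Finset.mul_sum, Finset.sum_neg_distrib]
      rw [Finset.sum_comm, ← Finset.sum_neg_distrib]
      refine Finset.sum_congr rfl fun k _ => ?_
      by_cases h : V.mem k j <;> simp [h, Matrix.mulVec, dotProduct]
    · intro b _ hb
      simp [hb.symm]
    · simp
    · intro b _ hb
      simp [hb.symm]
    · simp

theorem trace_D (S : Alignment d m) :
    (S.stackᵀ * V.D * S.stack).trace = (V.rotated S * (V.rotated S)ᵀ).trace := by
  classical
  simp only [Matrix.trace, Matrix.diag_apply]
  refine Finset.sum_congr rfl fun a _ => ?_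
  simp only [Matrix.mul_apply, Matrix.transpose_apply, Fintype.sum_prod_type, D,
      rotated, Matrix.of_apply, Alignment.stack]
  rw [Finset.sum_comm (s := (Finset.univ : Finset (Fin n)))]
  refine Finset.sum_congr rfl fun i _ => ?_
  have e : ∀ y : Fin d, (∑ j, ∑ b, (S j : Matrix (Fin d) (Fin d) ℝ) b a *
      (if j = i then ∑ k, (if V.mem k j then V.x k j b * V.x k j y else 0) else 0)) =
      ∑ k, ∑ b, (S i : Matrix (Fin d) (Fin d) ℝ) b a *
        (if V.mem k i then V.x k i b * V.x k i y else 0) := by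
    intro y
    rw [Finset.sum_eq_single i, Finset.sum_comm]
    · simp [Finset.mul_sum]
    · intro j _ hj
      simp [hj]
    · simp
  simp only [e, Finset.sum_mul]
  rw [Finset.sum_comm]
  refine Finset.sum_congr rfl fun k _ => ?_
  by_cases h : V.mem k i
  · simp only [h, if_true, Matrix.mulVec, dotProduct, Matrix.transpose_apply, Finset.sum_mul_sum]
    rw [Finset.sum_comm]
    refine Finset.sum_congr rfl fun b _ => Finset.sum_congr rfl fun c _ => ?_
    ring
  · simp [h]

/-- `F(S)` as the sum of the squares `‖S_iᵀ x_{k,i} + t_i - x_k‖²` for the optimal points and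
translations, which are the columns of `Sᵀ B 𝓛_Γ^†`. -/
theorem F_eq (S : Alignment d m) :
    V.F S = ((V.rotated S - S.stackᵀ * V.B * V.lapPinv * V.incidence) *
      (V.rotated S - S.stackᵀ * V.B * V.lapPinv * V.incidence)ᵀ).trace := by
  obtain ⟨-, h2, -, -⟩ := pinv_spec V.lap_isHermitian
  have h2' : V.lapPinv * V.incidence * V.incidenceᵀ * V.lapPinv = V.lapPinv := by
    rw [Matrix.mul_assoc V.lapPinv, ← lap_eq]
    exact h2
  have hsym : V.lapPinvᵀ = V.lapPinv := by
    rw [lapPinv, pinv, ← V.lap_isHermitian.cfc_eq, ← Matrix.conjTranspose_eq_transpose_of_trivial]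
    exact cfc_predicate (R := ℝ) (p := IsSelfAdjoint) _ V.lap
  have hB := V.stack_mul_B S
  have hB' : V.Bᵀ * S.stack = V.incidence * (V.rotated S)ᵀ := by
    have := congrArg Matrix.transpose hB
    simpa [Matrix.transpose_mul] using this
  have e1 : V.F S = (V.rotated S * (V.rotated S)ᵀ).trace -
      (V.rotated S * V.incidenceᵀ * V.lapPinv * V.incidence * (V.rotated S)ᵀ).trace := by
    rw [F, C, Matrix.mul_sub, Matrix.sub_mul, Matrix.trace_sub, trace_D]
    congr 2
    calc S.stackᵀ * (V.B * V.lapPinv * V.Bᵀ) * S.stack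
        = (S.stackᵀ * V.B) * V.lapPinv * (V.Bᵀ * S.stack) := by simp only [Matrix.mul_assoc]
      _ = _ := by rw [hB, hB']; simp only [Matrix.mul_assoc]
  rw [e1, hB, Matrix.transpose_sub, Matrix.mul_sub, Matrix.sub_mul, Matrix.sub_mul]
  simp only [Matrix.transpose_mul, Matrix.transpose_transpose, hsym, Matrix.trace_sub]
  have e2 : (V.rotated S * V.incidenceᵀ * V.lapPinv * V.incidence *
      (V.incidenceᵀ * (V.lapPinv * (V.incidence * (V.rotated S)ᵀ)))) =
      V.rotated S * V.incidenceᵀ * V.lapPinv * V.incidence * (V.rotated S)ᵀ := by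
    calc _ = V.rotated S * V.incidenceᵀ * (V.lapPinv * V.incidence * V.incidenceᵀ * V.lapPinv) *
          V.incidence * (V.rotated S)ᵀ := by simp only [Matrix.mul_assoc]
      _ = _ := by rw [h2']
  rw [e2]
  simp only [Matrix.mul_assoc]
  ring

/-- In a perfect alignment the displacement of two points of the `i`-th view in the realization is
the one in the view, aligned by `S_i`. -/
theorem realization_sub_realization {S : Alignment d m} (hS : V.IsPerfect S) {k l : Fin n}
    {i : Fin m} (hk : V.mem k i) (hl : V.mem l i) (a : Fin d) :
    V.realization S a k - V.realization S a l =
      ((S i : Matrix (Fin d) (Fin d) ℝ)ᵀ *ᵥ (V.x k i - V.x l i)) a := by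
  classical
  rw [IsPerfect, F_eq, ← Matrix.conjTranspose_eq_transpose_of_trivial (V.rotated S - _),
    Matrix.trace_mul_conjTranspose_self_eq_zero_iff, sub_eq_zero] at hS
  have key : ∀ k, V.mem k i → ((S i : Matrix (Fin d) (Fin d) ℝ)ᵀ *ᵥ V.x k i) a =
      (S.stackᵀ * V.B * V.lapPinv) a (.inl k) - (S.stackᵀ * V.B * V.lapPinv) a (.inr i) := by
    intro k hk
    have h := congrFun (congrFun hS a) (k, i)
    rw [Matrix.mul_apply, Fintype.sum_sum_type] at h
    simpa [rotated, incidence, hk, ← sub_eq_add_neg] using h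
  have hr : ∀ k, V.realization S a k = (S.stackᵀ * V.B * V.lapPinv) a (.inl k) -
      (n : ℝ)⁻¹ * ∑ j, (S.stackᵀ * V.B * V.lapPinv) a (.inl j) := by
    intro k
    rw [realization, Matrix.mul_sub, Matrix.mul_one, Matrix.sub_apply, Matrix.mul_smul,
      Matrix.smul_apply, Matrix.mul_apply]
    simp
  rw [hr, hr, Matrix.mulVec_sub, Pi.sub_apply, key k hk, key l hl]
  ring

end ViewSystem

/-! ### The quotient `𝕆(d)^m / ∼` and non-degenerate alignments -/

/-- `S ∼ O` iff `O = S Q` for some `Q ∈ 𝕆(d)`. -/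
def alignSetoid (d m : ℕ) : Setoid (Alignment d m) where
  r S O := ∃ Q : Matrix.orthogonalGroup (Fin d) ℝ, O = S.rightMul Q
  iseqv :=
    { refl := fun S => ⟨1, by funext i; simp [Alignment.rightMul]⟩
      symm := by
        rintro S O ⟨Q, rfl⟩
        exact ⟨Q⁻¹, by funext i; simp [Alignment.rightMul]⟩
      trans := by
        rintro S O P ⟨Q, rfl⟩ ⟨R, rfl⟩
        exact ⟨Q * R, by funext i; simp [Alignment.rightMul, mul_assoc]⟩ }

/-- `𝕆(d)^m / ∼`. -/
def AlignClass (d m : ℕ) : Type := Quotient (alignSetoid d m)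

/-- The projection `π : 𝕆(d)^m → 𝕆(d)^m / ∼`. -/
def proj {d m : ℕ} (S : Alignment d m) : AlignClass d m := Quotient.mk (alignSetoid d m) S

theorem stack_rightMul {d m : ℕ} (S : Alignment d m) (Q : Matrix.orthogonalGroup (Fin d) ℝ) :
    (S.rightMul Q).stack = S.stack * (Q : Matrix (Fin d) (Fin d) ℝ) := by
  ext p b
  simp [Alignment.stack, Alignment.rightMul, Matrix.mul_apply]

namespace ViewSystem

variable {d n m : ℕ} (V : ViewSystem d n m)

theorem F_rightMul (S : Alignment d m) (Q : Matrix.orthogonalGroup (Fin d) ℝ) :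
    V.F (S.rightMul Q) = V.F S := by
  have hQ : (Q : Matrix (Fin d) (Fin d) ℝ) * (Q : Matrix (Fin d) (Fin d) ℝ)ᵀ = 1 :=
    (Matrix.mem_orthogonalGroup_iff (Fin d) ℝ).mp Q.2
  rw [F, F, stack_rightMul, Matrix.transpose_mul, ← Matrix.mul_assoc, Matrix.trace_mul_comm,
    ← Matrix.mul_assoc, ← Matrix.mul_assoc, ← Matrix.mul_assoc, hQ, Matrix.one_mul]

/-- The function `F̃` on `𝕆(d)^m / ∼` induced by `F`. -/
def Ftilde : AlignClass d m → ℝ :=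
  Quotient.lift V.F (by
    rintro S O ⟨Q, rfl⟩
    exact (V.F_rightMul S Q).symm)

end ViewSystem

/-- The tangent space `T_S 𝕆(d)^m`: the tuples `Z` with all `S_iᵀ Z_i` skew-symmetric. -/
def tangentSpace {d m : ℕ} (S : Alignment d m) :
    Submodule ℝ (Fin m → Matrix (Fin d) (Fin d) ℝ) where
  carrier := {Z | ∀ i, ((S i : Matrix (Fin d) (Fin d) ℝ)ᵀ * Z i)ᵀ =
    -((S i : Matrix (Fin d) (Fin d) ℝ)ᵀ * Z i)}
  add_mem' := by
    intro Z W hZ hW i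
    rw [Pi.add_apply, Matrix.mul_add, Matrix.transpose_add, hZ i, hW i, neg_add]
  zero_mem' := by intro i; simp
  smul_mem' := by
    intro c Z hZ i
    rw [Pi.smul_apply, Matrix.mul_smul, Matrix.transpose_smul, hZ i, smul_neg]

/-- The horizontal space at `S`: the tangent vectors at `S` that are orthogonal, for
`g(Z, W) = ∑_i Tr(Z_iᵀ W_i)`, to the vertical space `{S Ω : Ω ∈ Skew(d)}`, which is the tangent space
of the fibre of `π` through `S`.  It is identified with the tangent space of `𝕆(d)^m / ∼` at
`π(S)`. -/
def horizontalSpace {d m : ℕ} (S : Alignment d m) :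
    Submodule ℝ (Fin m → Matrix (Fin d) (Fin d) ℝ) where
  carrier := {Z | Z ∈ tangentSpace S ∧ ∀ Ω : Matrix (Fin d) (Fin d) ℝ, Ωᵀ = -Ω →
    ∑ i, ((Z i)ᵀ * ((S i : Matrix (Fin d) (Fin d) ℝ) * Ω)).trace = 0}
  add_mem' := by
    rintro Z W ⟨hZ, hZ'⟩ ⟨hW, hW'⟩
    refine ⟨add_mem hZ hW, fun Ω hΩ => ?_⟩
    simp only [Pi.add_apply, Matrix.transpose_add, Matrix.add_mul, Matrix.trace_add,
      Finset.sum_add_distrib, hZ' Ω hΩ, hW' Ω hΩ, add_zero]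
  zero_mem' := ⟨zero_mem _, fun Ω _ => by simp⟩
  smul_mem' := by
    rintro c Z ⟨hZ, hZ'⟩
    refine ⟨Submodule.smul_mem _ c hZ, fun Ω hΩ => ?_⟩
    simp only [Pi.smul_apply, Matrix.transpose_smul, Matrix.smul_mul, Matrix.trace_smul,
      ← Finset.smul_sum, hZ' Ω hΩ, smul_zero]

theorem exp_skew_mem {d : ℕ} {A : Matrix (Fin d) (Fin d) ℝ} (hA : Aᵀ = -A) :
    NormedSpace.exp A ∈ Matrix.orthogonalGroup (Fin d) ℝ := by
  rw [Matrix.mem_orthogonalGroup_iff, ← Matrix.exp_transpose, hA, Matrix.exp_neg]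
  exact Matrix.mul_nonsing_inv _ ((Matrix.isUnit_iff_isUnit_det _).mp (Matrix.isUnit_exp A))

/-- The Riemannian exponential map `(S, Z) ↦ (S_i exp(S_iᵀ Z_i))_i` of `𝕆(d)^m`. -/
def expMap {d m : ℕ} (S : Alignment d m) (Z : tangentSpace S) : Alignment d m :=
  fun i => S i * ⟨NormedSpace.exp ((S i : Matrix (Fin d) (Fin d) ℝ)ᵀ * Z.1 i), exp_skew_mem (Z.2 i)⟩

/-- The Riemannian exponential map of `𝕆(d)^m / ∼` at `π(S)`: a tangent vector at `π(S)` is given by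
its horizontal lift `Z` at `S`, and horizontal geodesics project to geodesics. -/
def expQuot {d m : ℕ} (S : Alignment d m) (Z : horizontalSpace S) : AlignClass d m :=
  proj (expMap S ⟨Z.1, Z.2.1⟩)

namespace ViewSystem

variable {d n m : ℕ} (V : ViewSystem d n m)

/-- The differential of `F̃` at `π(S)`. -/
def dFtilde (S : Alignment d m) (Z : horizontalSpace S) : ℝ :=
  deriv (fun t : ℝ => V.Ftilde (expQuot S (t • Z))) 0

/-- The Riemannian Hessian `g̃(Hess F̃(π(S))[Z], W)` of `F̃` at `π(S)` as a bilinear form on the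
tangent space: the second derivatives at `0` of `F̃` in normal coordinates. -/
def hessFtilde (S : Alignment d m) (Z W : horizontalSpace S) : ℝ :=
  deriv (fun s : ℝ => deriv (fun t : ℝ => V.Ftilde (expQuot S (s • Z + t • W))) 0) 0

/-- A class in `𝕆(d)^m / ∼` is non-degenerate if it is a critical point of `F̃` at which the Hessian
of `F̃` is nonsingular. -/
def IsNondegenerate (c : AlignClass d m) : Prop :=
  ∀ S : Alignment d m, proj S = c →
    (∀ Z : horizontalSpace S, V.dFtilde S Z = 0) ∧
    ∀ Z : horizontalSpace S, (∀ W : horizontalSpace S, V.hessFtilde S Z W = 0) → Z = 0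

end ViewSystem

/-! ### Local rigidity -/

/-- The Frobenius norm. -/
def frobNorm {ι κ : Type*} [Fintype ι] [Fintype κ] (A : Matrix ι κ ℝ) : ℝ :=
  Real.sqrt (∑ a, ∑ b, A a b ^ 2)

/-- The realization `Θ(S)` of a perfect alignment `S` is locally rigid if the realizations close to
it that come from perfect alignments `O` are the `Θ(S Q)` with `Q ∈ 𝕆(d)`. -/
def ViewSystem.LocallyRigid {d n m : ℕ} (V : ViewSystem d n m) (S : Alignment d m) : Prop :=
  ∃ ε : ℝ, 0 < ε ∧ ∀ O : Alignment d m, V.IsPerfect O →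
    frobNorm (V.realization O - V.realization S) < ε →
      ∃ Q : Matrix.orthogonalGroup (Fin d) ℝ, V.realization O = V.realization (S.rightMul Q)

/-! ### The graph `𝔾` and the reduced graph `𝔾*(S)` -/

namespace ViewSystem

variable {d n m : ℕ} (V : ViewSystem d n m)

/-- The points contained in the views with indices in `A`. -/
def points (A : Set (Fin m)) : Set (Fin n) := {k | ∃ i ∈ A, V.mem k i}

/-- The aligned coordinates of the points in `T`, for a perfect alignment `S`. -/
def alignedCoords (S : Alignment d m) (T : Set (Fin n)) : Matrix (Fin d) T ℝ :=
  (V.realization S).submatrix id Subtype.val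

open Classical in
/-- The aligned coordinates of the points in `T`, multiplied by `I - n'⁻¹ 1 1ᵀ`, where `n'` is the
number of points in `T`. -/
def centeredCoords (S : Alignment d m) (T : Set (Fin n)) : Matrix (Fin d) T ℝ :=
  V.alignedCoords S T *
    (1 - (Fintype.card T : ℝ)⁻¹ • Matrix.of fun _ _ => 1 : Matrix T T ℝ)

open Classical in
/-- The rank of the matrix of centered aligned coordinates of the points in `T`. -/
def centeredRank (S : Alignment d m) (T : Set (Fin n)) : ℕ := (V.centeredCoords S T).rank

/-- The rank condition `rank ≥ d - 1` on the centered overlap matrix of `A` and `B`, that is, on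
`B(S)_{A,B} (I - n'⁻¹ 1 1ᵀ)`, where `B(S)_{A,B}` contains the aligned coordinates of the `n'` points
that the views in `A` share with the views in `B`.  For a perfect alignment these coordinates are, up
to one common translation (which the centering removes), the vectors `S_iᵀ x_{k,i} + t_i`, the same
for all views `i` containing `k`; see `realization_sub_realization`.  So for `A = {i}` and `B = {j}`
one may as well take the centered matrix with the columns `S_iᵀ x_{k,i}`. -/
def RankCond (S : Alignment d m) (A B : Set (Fin m)) : Prop :=
  d ≤ V.centeredRank S (V.points A ∩ V.points B) + 1

theorem RankCond.symm {S : Alignment d m} {A B : Set (Fin m)} (h : V.RankCond S A B) :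
    V.RankCond S B A := by
  unfold RankCond at *
  rwa [Set.inter_comm]

/-- The set of views merged into one vertex. -/
def block {m : ℕ} (r : Setoid (Fin m)) (v : Quotient r) : Set (Fin m) := {i | Quotient.mk r i = v}

/-- The graph built from the rank conditions when the views are merged along `r`: the vertices are
the merged views, and two of them are adjacent iff their centered overlap matrix has rank at least
`d - 1`. -/
def viewGraphOf (S : Alignment d m) (r : Setoid (Fin m)) : SimpleGraph (Quotient r) where
  Adj v w := v ≠ w ∧ V.RankCond S (block r v) (block r w)
  symm := ⟨fun _ _ h => ⟨h.1.symm, h.2.symm⟩⟩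
  loopless := ⟨fun _ h => h.1 rfl⟩

/-- The graph `𝔾` on the views: no views are merged. -/
def viewGraph (S : Alignment d m) : SimpleGraph (Quotient (⊥ : Setoid (Fin m))) :=
  V.viewGraphOf S ⊥

/-- One reduction step: all views in the same connected component are merged. -/
def coarsen (S : Alignment d m) (r : Setoid (Fin m)) : Setoid (Fin m) where
  r i j := (V.viewGraphOf S r).Reachable (Quotient.mk r i) (Quotient.mk r j)
  iseqv :=
    { refl := fun _ => SimpleGraph.Reachable.refl _
      symm := fun h => h.symm
      trans := fun h h' => h.trans h' }

/-- The result of the reduction: starting with `𝔾`, reduction steps are made until nothing changes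
any more.  As there are `m` views, this is the case after `m` steps. -/
def reducedSetoid (S : Alignment d m) : Setoid (Fin m) := (V.coarsen S)^[m] ⊥

/-- No further reduction is possible, that is, `𝔾*(S)` has no edges. -/
theorem coarsen_reducedSetoid (S : Alignment d m) :
    V.coarsen S (V.reducedSetoid S) = V.reducedSetoid S := by
  have hle : ∀ r, r ≤ V.coarsen S r := by
    intro r i j h
    change (V.viewGraphOf S r).Reachable _ _
    rw [Quotient.sound h]
  have hcard : ∀ r, V.coarsen S r ≠ r →
      Nat.card (Quotient (V.coarsen S r)) < Nat.card (Quotient r) := by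
    intro r hr
    by_contra hlt
    have hsurj : Function.Surjective
        (Quotient.map' (s₁ := r) (s₂ := V.coarsen S r) id fun _ _ h => hle r h) := by
      rintro ⟨i⟩
      exact ⟨Quotient.mk r i, rfl⟩
    have hbij := (Nat.bijective_iff_surjective_and_card _).mpr
      ⟨hsurj, le_antisymm (not_lt.mp hlt) (Nat.card_le_card_of_surjective _ hsurj)⟩
    refine hr (le_antisymm (fun {i j} h => ?_) (hle r))
    exact Quotient.exact (hbij.1 (Quotient.sound (s := V.coarsen S r) h :
      Quotient.mk (V.coarsen S r) i = Quotient.mk (V.coarsen S r) j))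
  have hstep : ∀ t : ℕ, V.coarsen S ((V.coarsen S)^[t] ⊥) = (V.coarsen S)^[t] ⊥ ∨
      Nat.card (Quotient ((V.coarsen S)^[t] ⊥)) + t ≤ m := by
    intro t
    induction t with
    | zero =>
      right
      have := Nat.card_le_card_of_surjective (Quotient.mk (⊥ : Setoid (Fin m)))
        Quotient.mk_surjective
      simpa using this
    | succ t ih =>
      rw [Function.iterate_succ_apply']
      by_cases h : V.coarsen S ((V.coarsen S)^[t] ⊥) = (V.coarsen S)^[t] ⊥
      · left
        rw [h, h]
      · right
        have h1 := hcard _ h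
        have h2 := ih.resolve_left h
        omega
  rcases hstep m with h | h
  · exact h
  · have h0 : Nat.card (Quotient (V.reducedSetoid S)) = 0 := by
      unfold reducedSetoid
      omega
    have hemp : IsEmpty (Fin m) := by
      rcases Nat.card_eq_zero.mp h0 with h1 | h1
      · exact ⟨fun i => h1.false (Quotient.mk _ i)⟩
      · exact absurd (inferInstance : Finite (Quotient (V.reducedSetoid S)))
          (not_finite_iff_infinite.mpr h1)
    exact Setoid.ext fun i => hemp.elim i

/-- The reduced graph `𝔾*(S)`. -/
def reducedGraph (S : Alignment d m) : SimpleGraph (Quotient (V.reducedSetoid S)) :=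
  V.viewGraphOf S (V.reducedSetoid S)

end ViewSystem

/-- The number of vertices of a graph. -/
def graphOrder {α : Type*} (_G : SimpleGraph α) : ℕ := Nat.card α

end RigidAlignment

end

/-! Write p for the realization of S. At a perfect alignment the error is a sum of squares of linear
functions that vanish there, so its Hessian at (Z, Z) is twice the sum of their squares at Z. A null
vector Z therefore gives point velocities that act on the displacements of p in each view i by the
skew matrix Z_iᵀ S_i. Likewise, another perfect alignment O acts on the displacements in view i by
the orthogonal matrix O_iᵀ S_i. Both claims ask whether these matrices, one per view, can be
replaced by a single one.

Since the reduced graph has one vertex, the set of all views arises from single views by joins along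
overlaps whose displacements span a subspace of codimension at most one (`glued_univ`). At each join
the matrices of the two sides agree on that subspace. For velocities, a skew matrix of rank at most
one is zero (`eq_zero_of_skew`), so the two sides agree, Z is vertical, and a vertical and
horizontal vector is zero. For rigidity, the two sides could differ by a reflection. If one side has
no displacements outside the overlap span, the matrix of the other side serves both. Otherwise both
sides span everything, and closeness of the realizations forces determinant 1 on both
(`eventually_nearRotations`); a rotation fixing a hyperplane is the identity
(`eq_one_of_orthogonal`).

For d ≤ 1 the rank condition is vacuous and overlaps may be empty. Then skew matrices and rotations
are trivial, and connectedness of Γ replaces the gluing for rigidity. -/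

namespace RigidAlignment

open Matrix

/-! ### Skew and orthogonal matrices trivial on a hyperplane -/

/-- A matrix that vanishes on a subspace of codimension at most one has rank at most one. -/
theorem exists_eq_vecMulVec {d : ℕ} {M : Matrix (Fin d) (Fin d) ℝ}
    {H : Submodule ℝ (Fin d → ℝ)} (hH : d ≤ Module.finrank ℝ H + 1)
    (hM : ∀ v ∈ H, M *ᵥ v = 0) : ∃ u w : Fin d → ℝ, M = vecMulVec u w := by
  have h1 := M.mulVecLin.finrank_range_add_finrank_ker
  have h2 : Module.finrank ℝ H ≤ Module.finrank ℝ (LinearMap.ker M.mulVecLin) :=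
    Submodule.finrank_mono fun v hv => hM v hv
  rw [Module.finrank_fin_fun] at h1
  have h3 : Module.finrank ℝ (LinearMap.range M.mulVecLin) ≤ 1 := by omega
  obtain ⟨u, hu⟩ := finrank_le_one_iff.mp h3
  choose c hc using hu
  refine ⟨u, fun j => c ⟨M *ᵥ Pi.single j 1, ⟨_, rfl⟩⟩, ?_⟩
  ext i j
  have := congrFun (congrArg Subtype.val (hc ⟨M *ᵥ Pi.single j 1, ⟨_, rfl⟩⟩)) i
  simp only [mulVec_single_one, Submodule.coe_smul, Pi.smul_apply, smul_eq_mul, col_apply] at this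
  rw [vecMulVec_apply, mul_comm]
  simpa using this.symm

theorem vecMulVec_eq_zero_of_dotProduct_sq {d : ℕ} {u w : Fin d → ℝ}
    (h : u ⬝ᵥ u * w ⬝ᵥ w = 0) : vecMulVec u w = 0 := by
  rcases mul_eq_zero.mp h with h | h <;> rw [dotProduct_self_eq_zero] at h <;> subst h <;> simp

/-- A skew-symmetric matrix that vanishes on a subspace of codimension at most one is zero. -/
theorem eq_zero_of_skew {d : ℕ} {M : Matrix (Fin d) (Fin d) ℝ} (hs : Mᵀ = -M)
    {H : Submodule ℝ (Fin d → ℝ)} (hH : d ≤ Module.finrank ℝ H + 1)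
    (hM : ∀ v ∈ H, M *ᵥ v = 0) : M = 0 := by
  obtain ⟨u, w, rfl⟩ := exists_eq_vecMulVec hH hM
  apply vecMulVec_eq_zero_of_dotProduct_sq
  have hc : ∀ i j, u j * w i = -(u i * w j) := fun i j => congrFun (congrFun hs i) j
  have ht : u ⬝ᵥ w = 0 := Finset.sum_eq_zero fun i _ => by linarith [hc i i]
  -- The left side is the sum of the squared entries of u wᵀ; skewness turns it into minus the
  -- square of the trace.
  have : u ⬝ᵥ u * w ⬝ᵥ w = -(u ⬝ᵥ w * u ⬝ᵥ w) := by
    simp only [dotProduct, Finset.sum_mul_sum, ← Finset.sum_neg_distrib]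
    refine Finset.sum_congr rfl fun i _ => Finset.sum_congr rfl fun j _ => ?_
    linear_combination (u i * w j) * hc i j
  rw [this, ht]
  simp

/-- A rotation that fixes a subspace of codimension at most one is the identity. -/
theorem eq_one_of_orthogonal {d : ℕ} {Q : Matrix (Fin d) (Fin d) ℝ} (hQ : Qᵀ * Q = 1)
    (hdet : Q.det = 1) {H : Submodule ℝ (Fin d → ℝ)} (hH : d ≤ Module.finrank ℝ H + 1)
    (hM : ∀ v ∈ H, Q *ᵥ v = v) : Q = 1 := by
  obtain ⟨u, w, h⟩ := exists_eq_vecMulVec (M := Q - 1) hH fun v hv => by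
    rw [sub_mulVec, hM v hv, one_mulVec, sub_self]
  obtain rfl : Q = 1 + vecMulVec u w := by rw [← h]; abel
  -- Matrix determinant lemma: det (1 + u wᵀ) = 1 + w · u.
  have ht : w ⬝ᵥ u = 0 := by
    rw [vecMulVec_eq Unit, det_one_add_replicateCol_mul_replicateRow] at hdet
    linarith
  rw [add_eq_left]
  apply vecMulVec_eq_zero_of_dotProduct_sq
  have e : ∀ i j, w i * u j + u i * w j + w i * (u ⬝ᵥ u) * w j = 0 := by
    intro i j
    have := congrFun (congrFun hQ i) j
    rw [transpose_add, transpose_one, add_mul, mul_add, one_mul, mul_add, mul_one,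
      transpose_vecMulVec, vecMulVec_mul_vecMulVec] at this
    simp only [Matrix.one_mul, Matrix.add_apply, vecMulVec_apply, Pi.smul_apply, smul_eq_mul]
      at this
    linarith
  -- The identity QᵀQ = 1 is evaluated as a quadratic form at w; as w · u = 0, only |u|²|w|⁴
  -- remains.
  have e2 : ∑ i, ∑ j, w i * w j * (w i * u j + u i * w j + w i * (u ⬝ᵥ u) * w j) =
      2 * (w ⬝ᵥ w) * (w ⬝ᵥ u) + (u ⬝ᵥ u) * (w ⬝ᵥ w) * (w ⬝ᵥ w) := by
    have e3 : ∀ i, ∑ j, w i * w j * (w i * u j + u i * w j + w i * (u ⬝ᵥ u) * w j) =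
        (w i * w i) * (w ⬝ᵥ u) + (w i * u i) * (w ⬝ᵥ w) +
          (w i * w i) * ((u ⬝ᵥ u) * (w ⬝ᵥ w)) := by
      intro i
      rw [show w ⬝ᵥ u = ∑ j, w j * u j from rfl, show w ⬝ᵥ w = ∑ j, w j * w j from rfl]
      simp only [Finset.mul_sum, ← Finset.sum_add_distrib]
      refine Finset.sum_congr rfl fun j _ => ?_
      ring
    simp only [e3, Finset.sum_add_distrib, ← Finset.sum_mul]
    change (w ⬝ᵥ w) * _ + (w ⬝ᵥ u) * _ + (w ⬝ᵥ w) * _ = _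
    ring
  simp only [e, ht, mul_zero, Finset.sum_const_zero, zero_add] at e2
  by_contra hne
  rcases mul_eq_zero.mp e2.symm with h | h
  · exact hne h
  · exact hne (by rw [h, mul_zero])

/-! ### Spans of displacements -/

/-- The span of the displacements between the columns of `p` with indices in `T`. -/
def diffSpan {d n : ℕ} (p : Matrix (Fin d) (Fin n) ℝ) (T : Set (Fin n)) :
    Submodule ℝ (Fin d → ℝ) :=
  Submodule.span ℝ {v | ∃ k ∈ T, ∃ l ∈ T, v = p.col k - p.col l}

theorem sub_mem_diffSpan {d n : ℕ} (p : Matrix (Fin d) (Fin n) ℝ) {T : Set (Fin n)} {k l : Fin n}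
    (hk : k ∈ T) (hl : l ∈ T) : p.col k - p.col l ∈ diffSpan p T :=
  Submodule.subset_span ⟨k, hk, l, hl, rfl⟩

theorem diffSpan_mono {d n : ℕ} (p : Matrix (Fin d) (Fin n) ℝ) {T U : Set (Fin n)} (h : T ⊆ U) :
    diffSpan p T ≤ diffSpan p U :=
  Submodule.span_mono fun _ ⟨k, hk, l, hl, e⟩ => ⟨k, h hk, l, h hl, e⟩

theorem diffSpan_eq_bot_of_empty {d n : ℕ} (p : Matrix (Fin d) (Fin n) ℝ) :
    diffSpan p ∅ = ⊥ := by
  simp [diffSpan]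

theorem mulVec_eq_of_mem_diffSpan {d n : ℕ} {p : Matrix (Fin d) (Fin n) ℝ} {T : Set (Fin n)}
    {M N : Matrix (Fin d) (Fin d) ℝ}
    (h : ∀ k ∈ T, ∀ l ∈ T, M *ᵥ (p.col k - p.col l) = N *ᵥ (p.col k - p.col l))
    {v : Fin d → ℝ} (hv : v ∈ diffSpan p T) : M *ᵥ v = N *ᵥ v := by
  have : diffSpan p T ≤ LinearMap.eqLocus M.mulVecLin N.mulVecLin := by
    rw [diffSpan, Submodule.span_le]
    rintro _ ⟨k, hk, l, hl, rfl⟩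
    exact h k hk l hl
  exact this hv

/-! ### The graph reduction as a gluing process -/

namespace ViewSystem
variable {d n m : ℕ} (V : ViewSystem d n m)

/-- A centered column is the average of the displacements from the points of T. -/
theorem centeredRank_le (S : Alignment d m) (T : Set (Fin n)) :
    V.centeredRank S T ≤ Module.finrank ℝ (diffSpan (V.realization S) T) := by
  classical
  rw [centeredRank, Matrix.rank_eq_finrank_span_cols]
  apply Submodule.finrank_mono
  rw [Submodule.span_le]
  rintro _ ⟨k, rfl⟩
  have hT : (Fintype.card T : ℝ) ≠ 0 := by
    have : Nonempty T := ⟨k⟩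
    exact_mod_cast Fintype.card_ne_zero
  have e : (V.centeredCoords S T).col k = (Fintype.card T : ℝ)⁻¹ •
      ∑ l : T, ((V.realization S).col k - (V.realization S).col l) := by
    ext a
    simp only [centeredCoords, alignedCoords, col_apply, Matrix.mul_sub, Matrix.mul_one,
      Matrix.sub_apply, submatrix_apply, id, Matrix.mul_smul, Matrix.smul_apply, Pi.smul_apply,
      Finset.sum_apply, Pi.sub_apply, Finset.sum_sub_distrib, Finset.sum_const, Finset.card_univ,
      smul_eq_mul, mul_sub, Matrix.mul_apply, of_apply, mul_one]
    rw [nsmul_eq_mul, inv_mul_cancel_left₀ hT]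
  rw [e]
  exact Submodule.smul_mem _ _ (Submodule.sum_mem _ fun l _ => sub_mem_diffSpan _ k.2 l.2)

theorem points_mono {A B : Set (Fin m)} (h : A ⊆ B) : V.points A ⊆ V.points B :=
  fun _ ⟨i, hi, hk⟩ => ⟨i, h hi, hk⟩

theorem points_union (A B : Set (Fin m)) : V.points (A ∪ B) = V.points A ∪ V.points B := by
  ext k
  simp [points, or_and_right, exists_or]

/-- The sets of views obtained from single views by repeatedly joining two sets whose common points
span an affine subspace of codimension at most one. -/
inductive Glued (p : Matrix (Fin d) (Fin n) ℝ) : Set (Fin m) → Prop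
  | single (i : Fin m) : Glued p {i}
  | union {A B : Set (Fin m)} : Glued p A → Glued p B →
      d ≤ Module.finrank ℝ (diffSpan p (V.points A ∩ V.points B)) + 1 → Glued p (A ∪ B)

/-- A connected component is assembled by adding one adjacent merged view at a time. This is allowed
because enlarging a side only enlarges the overlap. -/
theorem glued_block_coarsen {S : Alignment d m} {r : Setoid (Fin m)}
    (hr : ∀ v, V.Glued (V.realization S) (block r v)) (v : Quotient (V.coarsen S r)) :
    V.Glued (V.realization S) (block (V.coarsen S r) v) := by
  obtain ⟨i, rfl⟩ := Quotient.exists_rep v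
  let P : Set (Fin m) → Prop := fun A => V.Glued (V.realization S) A ∧
    block r (Quotient.mk r i) ⊆ A ∧ A ⊆ block (V.coarsen S r) (Quotient.mk _ i)
  have hblock : ∀ w, (V.viewGraphOf S r).Reachable (Quotient.mk r i) w →
      block r w ⊆ block (V.coarsen S r) (Quotient.mk _ i) := by
    intro w hw j (hj : Quotient.mk r j = w)
    refine Quotient.sound (s := V.coarsen S r) ?_
    change (V.viewGraphOf S r).Reachable _ _
    rw [hj]
    exact hw.symm
  -- A maximal glued set between the block of i and its component; by maximality it absorbs every
  -- block adjacent to a block that it contains.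
  obtain ⟨A, hA⟩ := (Set.toFinite {A | P A}).exists_maximal
    ⟨_, hr _, subset_rfl, hblock _ (SimpleGraph.Reachable.refl _)⟩
  obtain ⟨hA1, hA2, hA3⟩ : P A := hA.prop
  have key : ∀ w, (V.viewGraphOf S r).Reachable (Quotient.mk r i) w → block r w ⊆ A := by
    intro w hw
    rw [SimpleGraph.reachable_iff_reflTransGen] at hw
    induction hw with
    | refl => exact hA2
    | @tail b c hb hbc ih =>
      have hc : (V.viewGraphOf S r).Reachable (Quotient.mk r i) c :=
        (SimpleGraph.reachable_iff_reflTransGen _ _).mpr (hb.tail hbc)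
      have hrank : V.RankCond S (block r b) (block r c) := hbc.2
      have hP : P (A ∪ block r c) := by
        refine ⟨hA1.union (hr c) ?_, hA2.trans Set.subset_union_left,
          Set.union_subset hA3 (hblock c hc)⟩
        refine hrank.trans (Nat.add_le_add_right ((V.centeredRank_le S _).trans ?_) 1)
        exact Submodule.finrank_mono (diffSpan_mono _
          (Set.inter_subset_inter_left _ (V.points_mono ih)))
      exact Set.subset_union_right.trans (hA.le_of_ge hP Set.subset_union_left)
  have : A = block (V.coarsen S r) (Quotient.mk _ i) := by
    refine hA3.antisymm fun j hj => key (Quotient.mk r j) ?_ rfl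
    exact (Quotient.exact (s := V.coarsen S r) hj).symm
  exact this ▸ hA1

theorem glued_univ {S : Alignment d m} (hG : graphOrder (V.reducedGraph S) = 1) :
    V.Glued (V.realization S) Set.univ := by
  have hb : ∀ v, V.Glued (V.realization S) (block (V.reducedSetoid S) v) := by
    have : ∀ t : ℕ, ∀ v, V.Glued (V.realization S) (block ((V.coarsen S)^[t] ⊥) v) := by
      intro t
      induction t with
      | zero =>
        intro v
        obtain ⟨i, rfl⟩ := Quotient.exists_rep v
        have : block (⊥ : Setoid (Fin m)) (Quotient.mk _ i) = {i} := by
          ext j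
          exact ⟨fun h => Quotient.exact (s := (⊥ : Setoid (Fin m))) h,
            fun h => congrArg _ h⟩
        exact this ▸ Glued.single i
      | succ t ih =>
        rw [Function.iterate_succ_apply']
        exact V.glued_block_coarsen ih
    exact this m
  obtain ⟨hs, ⟨v⟩⟩ := Nat.card_eq_one_iff_unique.mp hG
  have : block (V.reducedSetoid S) v = Set.univ :=
    Set.eq_univ_of_forall fun i => Subsingleton.elim _ _
  exact this ▸ hb v

end ViewSystem

/-! ### Second derivatives along exponential curves -/

section Curve
-- The norm serves only to differentiate the matrix exponential; the derivatives of the real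
-- functions below do not depend on it.
attribute [local instance] Matrix.linftyOpNormedRing Matrix.linftyOpNormedAlgebra

theorem hasDerivAt_linear_exp {d m : ℕ} (f : (Fin m → Matrix (Fin d) (Fin d) ℝ) →ₗ[ℝ] ℝ)
    (Y Ω : Fin m → Matrix (Fin d) (Fin d) ℝ) (s : ℝ) :
    HasDerivAt (fun s : ℝ => f fun i => Y i * NormedSpace.exp (s • Ω i))
      (f fun i => Y i * NormedSpace.exp (s • Ω i) * Ω i) s := by
  have h : HasDerivAt (fun s : ℝ => fun i => Y i * NormedSpace.exp (s • Ω i))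
      (fun i => Y i * NormedSpace.exp (s • Ω i) * Ω i) s := by
    refine hasDerivAt_pi.mpr fun i => ?_
    rw [Matrix.mul_assoc]
    exact (hasDerivAt_exp_smul_const (Ω i) s).const_mul (Y i)
  exact (LinearMap.toContinuousLinearMap f).hasFDerivAt.comp_hasDerivAt s h

end Curve

/-- The second derivative at a zero of the sum of squares of linear functions along the curve
`s ↦ Y exp(s Ω)`. -/
theorem deriv_deriv_sum_sq {ι : Type*} [Fintype ι] {d m : ℕ}
    (f : ι → (Fin m → Matrix (Fin d) (Fin d) ℝ) →ₗ[ℝ] ℝ)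
    (Y Ω : Fin m → Matrix (Fin d) (Fin d) ℝ) (h0 : ∀ e, f e Y = 0) :
    deriv (deriv fun s : ℝ => ∑ e, (f e fun i => Y i * NormedSpace.exp (s • Ω i)) ^ 2) 0 =
      2 * ∑ e, (f e fun i => Y i * Ω i) ^ 2 := by
  have h1 : ∀ e s, HasDerivAt (fun s : ℝ => f e fun i => Y i * NormedSpace.exp (s • Ω i))
      (f e fun i => Y i * NormedSpace.exp (s • Ω i) * Ω i) s :=
    fun e s => hasDerivAt_linear_exp (f e) Y Ω s
  -- Right multiplication by Ω is linear, so the second derivative is the first one for f ∘ R.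
  let R : (Fin m → Matrix (Fin d) (Fin d) ℝ) →ₗ[ℝ] (Fin m → Matrix (Fin d) (Fin d) ℝ) :=
    LinearMap.mulRight ℝ Ω
  have h2 : ∀ e s, HasDerivAt
      (fun s : ℝ => f e fun i => Y i * NormedSpace.exp (s • Ω i) * Ω i)
      (f e fun i => Y i * NormedSpace.exp (s • Ω i) * Ω i * Ω i) s :=
    fun e s => hasDerivAt_linear_exp (f e ∘ₗ R) Y Ω s
  have h3 : (deriv fun s : ℝ => ∑ e, (f e fun i => Y i * NormedSpace.exp (s • Ω i)) ^ 2) =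
      fun s => ∑ e, 2 * ((f e fun i => Y i * NormedSpace.exp (s • Ω i)) *
        f e fun i => Y i * NormedSpace.exp (s • Ω i) * Ω i) := by
    funext s
    refine (HasDerivAt.fun_sum fun e _ => ((h1 e s).pow 2).congr_deriv ?_).deriv
    simp [mul_assoc]
  rw [h3]
  -- In the product rule the terms with exp''-type factors carry f e Y = 0 and drop out.
  refine (HasDerivAt.fun_sum fun e _ => ((h1 e 0).mul (h2 e 0)).const_mul 2).deriv.trans ?_
  simp [h0, Finset.mul_sum, sq]

/-! ### The error as a sum of squares, its derivatives and its invariance -/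

namespace ViewSystem
variable {d n m : ℕ} (V : ViewSystem d n m)

open Classical in
/-- The linear extension of `rotated` to tuples of matrices. -/
noncomputable def rotatedLin :
    (Fin m → Matrix (Fin d) (Fin d) ℝ) →ₗ[ℝ] Matrix (Fin d) (Fin n × Fin m) ℝ where
  toFun Y := Matrix.of fun a e => if V.mem e.1 e.2 then ((Y e.2)ᵀ *ᵥ V.x e.1 e.2) a else 0
  map_add' Y W := by
    ext a e
    by_cases h : V.mem e.1 e.2 <;> simp [h, add_mulVec]
  map_smul' c Y := by
    ext a e
    by_cases h : V.mem e.1 e.2 <;> simp [h, smul_mulVec]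

/-- The residuals of the coordinates `Y_iᵀ x_{k,i}` with respect to the optimal points and
translations. -/
noncomputable def residual :
    (Fin m → Matrix (Fin d) (Fin d) ℝ) →ₗ[ℝ] Matrix (Fin d) (Fin n × Fin m) ℝ where
  toFun Y := V.rotatedLin Y - V.rotatedLin Y * V.incidenceᵀ * V.lapPinv * V.incidence
  map_add' Y W := by
    rw [map_add]
    simp only [Matrix.add_mul]
    abel
  map_smul' c Y := by
    rw [map_smul]
    simp only [Matrix.smul_mul, smul_sub, RingHom.id_apply]

/-- An entry of the residual. -/
noncomputable def residualEntry (e : Fin d × (Fin n × Fin m)) :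
    (Fin m → Matrix (Fin d) (Fin d) ℝ) →ₗ[ℝ] ℝ :=
  Matrix.entryLinearMap ℝ ℝ e.1 e.2 ∘ₗ V.residual

theorem F_eq_sum_sq (S : Alignment d m) :
    V.F S = ∑ e, V.residualEntry e (fun i => (S i : Matrix (Fin d) (Fin d) ℝ)) ^ 2 := by
  rw [F_eq, V.stack_mul_B, Fintype.sum_prod_type]
  simp only [Matrix.trace, Matrix.diag_apply, Matrix.mul_apply (M := _ - _),
    Matrix.transpose_apply, ← sq]
  rfl

theorem F_nonneg (S : Alignment d m) : 0 ≤ V.F S := by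
  rw [F_eq_sum_sq]
  positivity

theorem residualEntry_eq_zero {S : Alignment d m} (hS : V.IsPerfect S)
    (e : Fin d × (Fin n × Fin m)) :
    V.residualEntry e (fun i => (S i : Matrix (Fin d) (Fin d) ℝ)) = 0 := by
  rw [IsPerfect, F_eq_sum_sq, Finset.sum_eq_zero_iff_of_nonneg fun e _ => sq_nonneg _] at hS
  exact pow_eq_zero_iff (two_ne_zero) |>.mp (hS e (Finset.mem_univ _))

theorem expMap_zero (S : Alignment d m) : expMap S 0 = S := by
  funext i
  ext a b
  simp [expMap]

/-- A perfect alignment is a global minimum, since the error is nonnegative. -/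
theorem dFtilde_eq_zero {S : Alignment d m} (hS : V.IsPerfect S) (Z : horizontalSpace S) :
    V.dFtilde S Z = 0 := by
  refine IsLocalMin.deriv_eq_zero (Filter.Eventually.of_forall fun t => ?_)
  have h0 : V.Ftilde (expQuot S ((0 : ℝ) • Z)) = 0 := by
    rw [zero_smul]
    change V.F (expMap S 0) = 0
    rwa [expMap_zero]
  exact h0.trans_le (V.F_nonneg _)

theorem hessFtilde_self {S : Alignment d m} (hS : V.IsPerfect S) (Z : horizontalSpace S) :
    V.hessFtilde S Z Z = 2 * ∑ e, V.residualEntry e Z.1 ^ 2 := by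
  have hφ : ∀ s : ℝ, V.Ftilde (expQuot S (s • Z)) =
      ∑ e, V.residualEntry e (fun i => (S i : Matrix (Fin d) (Fin d) ℝ) *
        NormedSpace.exp (s • ((S i : Matrix (Fin d) (Fin d) ℝ)ᵀ * Z.1 i))) ^ 2 := by
    intro s
    refine (V.F_eq_sum_sq _).trans ?_
    refine Finset.sum_congr rfl fun e _ => congrArg (fun Y => V.residualEntry e Y ^ 2) ?_
    funext i
    simp [expMap]
  -- With both directions equal to Z the mixed derivative is the second derivative along one
  -- geodesic, with parameter s + t.
  have hd : (fun s : ℝ => deriv (fun t : ℝ => V.Ftilde (expQuot S (s • Z + t • Z))) 0) =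
      deriv fun s : ℝ => V.Ftilde (expQuot S (s • Z)) := by
    funext s
    simp only [← add_smul]
    rw [deriv_comp_const_add (f := fun s : ℝ => V.Ftilde (expQuot S (s • Z))), add_zero]
  rw [hessFtilde, hd]
  simp only [hφ]
  rw [deriv_deriv_sum_sq V.residualEntry _ _ (V.residualEntry_eq_zero hS)]
  congr! 6 with e _ i
  rw [← Matrix.mul_assoc, (Matrix.mem_orthogonalGroup_iff (Fin d) ℝ).mp (S i).2, Matrix.one_mul]

/-- Infinitesimal motions that do not change the error to second order move the points of every
view by an infinitesimal rigid motion, up to translations. -/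
theorem exists_velocity {Z : Fin m → Matrix (Fin d) (Fin d) ℝ} (hZ : V.residual Z = 0) :
    ∃ v : Matrix (Fin d) (Fin n) ℝ, ∀ k l i, V.mem k i → V.mem l i →
      v.col k - v.col l = (Z i)ᵀ *ᵥ (V.x k i - V.x l i) := by
  classical
  -- The velocities are the optimal points for the linearized data; the entries of the views act as
  -- translations and cancel in differences.
  refine ⟨(V.rotatedLin Z * V.incidenceᵀ * V.lapPinv).submatrix id Sum.inl, ?_⟩
  have h : V.rotatedLin Z = V.rotatedLin Z * V.incidenceᵀ * V.lapPinv * V.incidence :=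
    sub_eq_zero.mp hZ
  have key : ∀ k i a, V.mem k i → ((Z i)ᵀ *ᵥ V.x k i) a =
      (V.rotatedLin Z * V.incidenceᵀ * V.lapPinv) a (.inl k) -
        (V.rotatedLin Z * V.incidenceᵀ * V.lapPinv) a (.inr i) := by
    intro k i a hk
    have h' := congrFun (congrFun h a) (k, i)
    rw [Matrix.mul_apply, Fintype.sum_sum_type] at h'
    have h1 : V.rotatedLin Z a (k, i) = ((Z i)ᵀ *ᵥ V.x k i) a := if_pos hk
    rw [← h1, h']
    simp [incidence, hk, ← sub_eq_add_neg]
  intro k l i hk hl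
  ext a
  rw [mulVec_sub, Pi.sub_apply, Pi.sub_apply, key k i a hk, key l i a hl]
  simp

theorem realization_col_sub {S : Alignment d m} (hS : V.IsPerfect S) {k l : Fin n}
    {i : Fin m} (hk : V.mem k i) (hl : V.mem l i) :
    (V.realization S).col k - (V.realization S).col l =
      (S i : Matrix (Fin d) (Fin d) ℝ)ᵀ *ᵥ (V.x k i - V.x l i) :=
  funext fun a => V.realization_sub_realization hS hk hl a

theorem realization_rightMul (S : Alignment d m) (Q : Matrix.orthogonalGroup (Fin d) ℝ) :
    V.realization (S.rightMul Q) = (Q : Matrix (Fin d) (Fin d) ℝ)ᵀ * V.realization S := by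
  rw [realization, realization, stack_rightMul, Matrix.transpose_mul]
  simp only [Matrix.mul_assoc]
  exact Matrix.mul_assoc (Q : Matrix (Fin d) (Fin d) ℝ)ᵀ
    ((S.stackᵀ * (V.B * V.lapPinv)).submatrix id Sum.inl) _

theorem rankCond_rightMul (S : Alignment d m) (Q : Matrix.orthogonalGroup (Fin d) ℝ)
    (A B : Set (Fin m)) : V.RankCond (S.rightMul Q) A B ↔ V.RankCond S A B := by
  classical
  have hQ : IsUnit (Q : Matrix (Fin d) (Fin d) ℝ)ᵀ.det :=
    Matrix.isUnit_det_of_left_inverse ((Matrix.mem_orthogonalGroup_iff (Fin d) ℝ).mp Q.2)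
  have : ∀ T, V.centeredRank (S.rightMul Q) T = V.centeredRank S T := by
    intro T
    have h : V.centeredCoords (S.rightMul Q) T =
        (Q : Matrix (Fin d) (Fin d) ℝ)ᵀ * V.centeredCoords S T := by
      rw [centeredCoords, centeredCoords, alignedCoords, realization_rightMul, ← Matrix.mul_assoc]
      rfl
    rw [centeredRank, h, Matrix.rank_mul_eq_right_of_isUnit_det _ _ hQ, centeredRank]
  rw [RankCond, RankCond, this]

/-- Non-degeneracy is tested at every representative S Q of the class, so the hypothesis on the
graph has to be transported to it. -/
theorem graphOrder_reducedGraph_rightMul (S : Alignment d m)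
    (Q : Matrix.orthogonalGroup (Fin d) ℝ) :
    graphOrder (V.reducedGraph (S.rightMul Q)) = graphOrder (V.reducedGraph S) := by
  have h1 : V.viewGraphOf (S.rightMul Q) = V.viewGraphOf S := by
    funext r
    ext v w
    exact and_congr_right fun _ => V.rankCond_rightMul S Q _ _
  have h2 : V.coarsen (S.rightMul Q) = V.coarsen S := by
    funext r
    ext i j
    change (V.viewGraphOf _ r).Reachable _ _ ↔ (V.viewGraphOf _ r).Reachable _ _
    rw [h1]
  rw [graphOrder, graphOrder, reducedSetoid, reducedSetoid, h2]

end ViewSystem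
-- Gluing velocities and non-degeneracy
namespace ViewSystem
variable {d n m : ℕ} (V : ViewSystem d n m)

theorem transpose_mul_coe (Q : Matrix.orthogonalGroup (Fin d) ℝ) :
    (Q : Matrix (Fin d) (Fin d) ℝ)ᵀ * (Q : Matrix (Fin d) (Fin d) ℝ) = 1 :=
  (Matrix.mem_orthogonalGroup_iff' (Fin d) ℝ).mp Q.2

theorem mul_transpose_coe (Q : Matrix.orthogonalGroup (Fin d) ℝ) :
    (Q : Matrix (Fin d) (Fin d) ℝ) * (Q : Matrix (Fin d) (Fin d) ℝ)ᵀ = 1 :=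
  (Matrix.mem_orthogonalGroup_iff (Fin d) ℝ).mp Q.2

/-- From dimension two on, the rank condition forces a common point, which serves as base point when
two sets of views are joined. -/
theorem exists_mem_of_finrank {p : Matrix (Fin d) (Fin n) ℝ} {T : Set (Fin n)} (hd : 2 ≤ d)
    (h : d ≤ Module.finrank ℝ (diffSpan p T) + 1) : ∃ k, k ∈ T := by
  by_contra hT
  rw [← Set.Nonempty, Set.not_nonempty_iff_eq_empty] at hT
  rw [hT, diffSpan_eq_bot_of_empty, finrank_bot] at h
  omega

variable {V} in
/-- If the points of every view move by an infinitesimal rotation, up to translations, then the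
points of a glued set of views move by a single one. -/
theorem Glued.exists_skew {p v : Matrix (Fin d) (Fin n) ℝ} (hd : 2 ≤ d)
    {Ω : Fin m → Matrix (Fin d) (Fin d) ℝ} (hΩ : ∀ i, (Ω i)ᵀ = -Ω i)
    (hv : ∀ k l i, V.mem k i → V.mem l i → v.col k - v.col l = Ω i *ᵥ (p.col k - p.col l))
    {A : Set (Fin m)} (hA : V.Glued p A) :
    ∃ M : Matrix (Fin d) (Fin d) ℝ, Mᵀ = -M ∧ (∀ i ∈ A, Ω i = M) ∧
      ∀ k ∈ V.points A, ∀ l ∈ V.points A, v.col k - v.col l = M *ᵥ (p.col k - p.col l) := by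
  induction hA with
  | single i =>
    refine ⟨Ω i, hΩ i, by simp, ?_⟩
    rintro k ⟨_, rfl, hk⟩ l ⟨_, rfl, hl⟩
    exact hv k l _ hk hl
  | @union A B _ _ h ihA ihB =>
    obtain ⟨M, hM, hMA, hMv⟩ := ihA
    obtain ⟨N, hN, hNB, hNv⟩ := ihB
    have hMN : M = N := by
      refine sub_eq_zero.mp (eq_zero_of_skew ?_ h fun x hx => ?_)
      · rw [transpose_sub, hM, hN]
        abel
      · rw [sub_mulVec, sub_eq_zero]
        refine mulVec_eq_of_mem_diffSpan (fun k hk l hl => ?_) hx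
        rw [← hMv k hk.1 l hl.1, ← hNv k hk.2 l hl.2]
    subst hMN
    obtain ⟨o, hoA, hoB⟩ := exists_mem_of_finrank hd h
    refine ⟨M, hM, fun i hi => hi.elim (hMA i) (hNB i), ?_⟩
    -- Agreement of the two matrices is not enough: displacements between the two sides are split at
    -- the common point o.
    have key : ∀ k ∈ V.points (A ∪ B), v.col k - v.col o = M *ᵥ (p.col k - p.col o) := by
      rw [V.points_union]
      rintro k (hk | hk)
      exacts [hMv k hk o hoA, hNv k hk o hoB]
    intro k hk l hl
    rw [← sub_sub_sub_cancel_right _ _ (v.col o), key k hk, key l hl, ← mulVec_sub,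
      sub_sub_sub_cancel_right]

/-- Such a Z is both horizontal and vertical, hence orthogonal to itself. -/
theorem eq_zero_of_vertical {S : Alignment d m} (Z : horizontalSpace S)
    {Ω : Matrix (Fin d) (Fin d) ℝ} (hΩ : Ωᵀ = -Ω)
    (h : ∀ i, Z.1 i = (S i : Matrix (Fin d) (Fin d) ℝ) * Ω) : Z = 0 := by
  have h0 := Z.2.2 Ω hΩ
  simp only [← h] at h0
  rw [Finset.sum_eq_zero_iff_of_nonneg] at h0
  · ext1
    funext i
    have := h0 i (Finset.mem_univ _)
    rw [← Matrix.conjTranspose_eq_transpose_of_trivial,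
      Matrix.trace_conjTranspose_mul_self_eq_zero_iff] at this
    exact this
  · intro i _
    rw [← Matrix.conjTranspose_eq_transpose_of_trivial]
    exact (Matrix.posSemidef_conjTranspose_mul_self _).trace_nonneg

theorem eq_zero_of_hessFtilde_eq_zero {S : Alignment d m} (hS : V.IsPerfect S)
    (hG : graphOrder (V.reducedGraph S) = 1) {Z : horizontalSpace S}
    (hZ : V.hessFtilde S Z Z = 0) : Z = 0 := by
  have hres : V.residual Z.1 = 0 := by
    rw [V.hessFtilde_self hS, mul_eq_zero, or_iff_right two_ne_zero,
      Finset.sum_eq_zero_iff_of_nonneg fun e _ => sq_nonneg _] at hZ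
    ext a e
    exact pow_eq_zero_iff two_ne_zero |>.mp (hZ (a, e) (Finset.mem_univ _))
  obtain ⟨v, hv⟩ := V.exists_velocity hres
  -- Ω_i = Z_iᵀ S_i, because Z_iᵀ (x_k - x_l) = Z_iᵀ S_i (p_k - p_l) for the realization p.
  let Ω : Fin m → Matrix (Fin d) (Fin d) ℝ := fun i =>
    ((S i : Matrix (Fin d) (Fin d) ℝ)ᵀ * Z.1 i)ᵀ
  have hΩ : ∀ i, (Ω i)ᵀ = -Ω i := fun i => by
    simp only [Ω]
    rw [Z.2.1 i, transpose_neg, Z.2.1 i]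
  have hZΩ : ∀ i, Z.1 i = (S i : Matrix (Fin d) (Fin d) ℝ) * (Ω i)ᵀ := fun i => by
    simp only [Ω]
    rw [transpose_transpose, ← Matrix.mul_assoc, mul_transpose_coe, Matrix.one_mul]
  rcases Nat.lt_or_ge d 2 with hd | hd
  · refine eq_zero_of_vertical Z (Ω := 0) (by simp) fun i => ?_
    have h0 : Ω i = 0 := eq_zero_of_skew (H := ⊥) (hΩ i) (by rw [finrank_bot]; omega)
      fun x hx => by rw [(Submodule.mem_bot ℝ).mp hx, mulVec_zero]
    rw [hZΩ, h0, transpose_zero]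
  · obtain ⟨M, hM, hMΩ, -⟩ := (V.glued_univ hG).exists_skew (v := v) hd hΩ fun k l i hk hl => by
      rw [hv k l i hk hl, V.realization_col_sub hS hk hl, mulVec_mulVec]
      simp only [Ω]
      rw [transpose_mul, transpose_transpose, Matrix.mul_assoc, mul_transpose_coe, Matrix.mul_one]
    refine eq_zero_of_vertical Z (Ω := Mᵀ) (by rw [hM, transpose_neg, hM]) fun i => ?_
    rw [hZΩ, hMΩ i (Set.mem_univ i)]

theorem isNondegenerate {S : Alignment d m} (hS : V.IsPerfect S)
    (hG : graphOrder (V.reducedGraph S) = 1) : V.IsNondegenerate (proj S) := by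
  intro O hO
  obtain ⟨Q, rfl⟩ : ∃ Q, O = S.rightMul Q := Quotient.exact (s := alignSetoid d m) hO.symm
  have hP : V.IsPerfect (S.rightMul Q) := (V.F_rightMul S Q).trans hS
  refine ⟨V.dFtilde_eq_zero hP, fun Z hZ => V.eq_zero_of_hessFtilde_eq_zero hP ?_ (hZ Z)⟩
  rw [graphOrder_reducedGraph_rightMul, hG]

/-! ### Local rigidity -/

/-- If `q` arises from `p` on the points `T` by an orthogonal map, then that map is a rotation,
provided that these points are affinely spanning and `q` is close to `p`. -/
def NearRotations (p q : Matrix (Fin d) (Fin n) ℝ) : Prop :=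
  ∀ (T : Set (Fin n)) (R : Matrix (Fin d) (Fin d) ℝ), R * Rᵀ = 1 → diffSpan p T = ⊤ →
    (∀ k ∈ T, ∀ l ∈ T, q.col k - q.col l = R *ᵥ (p.col k - p.col l)) → R.det = 1

/-- Spanning displacements of p form an invertible matrix, which R carries to the corresponding
matrix of q. Near p the determinants have the same sign, so det R > 0. There are finitely many
choices of index pairs, so one neighbourhood serves all T and R. -/
theorem eventually_nearRotations (p : Matrix (Fin d) (Fin n) ℝ) :
    ∀ᶠ q in nhds p, NearRotations p q := by
  let P : Matrix (Fin d) (Fin n) ℝ → (Fin d → Fin n × Fin n) → Matrix (Fin d) (Fin d) ℝ :=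
    fun q f => Matrix.of fun a j => q a (f j).1 - q a (f j).2
  have hP : ∀ f, Continuous fun q => (P q f).det := fun f =>
    Continuous.matrix_det (by
      refine continuous_matrix fun a j => ?_
      exact (continuous_id.matrix_elem _ _).sub (continuous_id.matrix_elem _ _))
  have hev : ∀ᶠ q in nhds p, ∀ f, (P p f).det ≠ 0 → 0 < (P q f).det * (P p f).det := by
    rw [Filter.eventually_all]
    intro f
    by_cases h : (P p f).det = 0
    · exact Filter.Eventually.of_forall fun q h' => absurd h h'
    · have : 0 < (P p f).det * (P p f).det := mul_self_pos.mpr h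
      filter_upwards [((hP f).mul continuous_const).continuousAt.eventually
        (lt_mem_nhds this)] with q hq _ using hq
  filter_upwards [hev] with q hq T R hR hT hqR
  have hdet : R.det * R.det = 1 := by
    rw [← congrArg Matrix.det hR |>.trans Matrix.det_one, Matrix.det_mul, Matrix.det_transpose]
  -- A basis chosen among the displacements themselves; its length is a `finrank`, which is then
  -- identified with d.
  obtain ⟨g, hg, -, hli⟩ := Submodule.exists_fun_fin_finrank_span_eq ℝ
    {v | ∃ k ∈ T, ∃ l ∈ T, v = p.col k - p.col l}
  have hfin : Module.finrank ℝ (Submodule.span ℝ {v | ∃ k ∈ T, ∃ l ∈ T, v = p.col k - p.col l}) =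
      d := by
    change Module.finrank ℝ (diffSpan p T) = d
    rw [hT, finrank_top, Module.finrank_fin_fun]
  generalize Module.finrank ℝ
    (Submodule.span ℝ {v | ∃ k ∈ T, ∃ l ∈ T, v = p.col k - p.col l}) = d' at g hg hli hfin
  subst hfin
  choose k hk l hl hkl using hg
  let f : Fin d' → Fin n × Fin n := fun j => (k j, l j)
  have hcol : (P p f).col = g := by
    funext j
    rw [hkl j]
    rfl
  have hne : (P p f).det ≠ 0 := by
    rw [← isUnit_iff_ne_zero, ← Matrix.isUnit_iff_isUnit_det,
      ← Matrix.linearIndependent_cols_iff_isUnit, hcol]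
    exact hli
  have hmul : P q f = R * P p f := by
    ext a j
    have := congrFun (hqR (k j) (hk j) (l j) (hl j)) a
    simpa [P, f, Matrix.mul_apply, mulVec, dotProduct] using this
  have hpos := hq f hne
  rw [hmul, Matrix.det_mul, mul_assoc] at hpos
  have : 0 < R.det := pos_of_mul_pos_left hpos (mul_self_nonneg _)
  nlinarith

theorem transpose_mul_mulVec_of_eq {Q R : Matrix (Fin d) (Fin d) ℝ} (hQ : Q * Qᵀ = 1)
    {v : Fin d → ℝ} (h : R *ᵥ v = Q *ᵥ v) : (Qᵀ * R) *ᵥ v = v := by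
  rw [← mulVec_mulVec, h, mulVec_mulVec, mul_eq_one_comm.mp hQ, one_mulVec]

variable {V} in
/-- If the points of every view are moved by an orthogonal map, up to translations, to nearby points,
then the points of a glued set of views are moved by a single one. -/
theorem Glued.exists_orthogonal {p q : Matrix (Fin d) (Fin n) ℝ} (hd : 2 ≤ d)
    (hpq : NearRotations p q)
    {R : Fin m → Matrix (Fin d) (Fin d) ℝ} (hR : ∀ i, R i * (R i)ᵀ = 1)
    (hq : ∀ k l i, V.mem k i → V.mem l i → q.col k - q.col l = R i *ᵥ (p.col k - p.col l))
    {A : Set (Fin m)} (hA : V.Glued p A) :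
    ∃ M : Matrix (Fin d) (Fin d) ℝ, M * Mᵀ = 1 ∧
      ∀ k ∈ V.points A, ∀ l ∈ V.points A, q.col k - q.col l = M *ᵥ (p.col k - p.col l) := by
  induction hA with
  | single i =>
    refine ⟨R i, hR i, ?_⟩
    rintro k ⟨_, rfl, hk⟩ l ⟨_, rfl, hl⟩
    exact hq k l _ hk hl
  | @union A B _ _ h ihA ihB =>
    obtain ⟨M, hM, hMq⟩ := ihA
    obtain ⟨N, hN, hNq⟩ := ihB
    have hMN : ∀ x ∈ diffSpan p (V.points A ∩ V.points B), M *ᵥ x = N *ᵥ x := fun x hx =>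
      mulVec_eq_of_mem_diffSpan (fun k hk l hl => by
        rw [← hMq k hk.1 l hl.1, ← hNq k hk.2 l hl.2]) hx
    -- A subspace strictly larger than one of codimension at most one is the whole space.
    have htop : ∀ {C : Set (Fin m)}, V.points A ∩ V.points B ⊆ V.points C →
        ¬diffSpan p (V.points C) ≤ diffSpan p (V.points A ∩ V.points B) →
        diffSpan p (V.points C) = ⊤ := by
      intro C hC hn
      have := Submodule.finrank_lt_finrank_of_lt (lt_of_le_not_ge (diffSpan_mono p hC) hn)
      refine Submodule.eq_top_of_finrank_eq (le_antisymm (Submodule.finrank_le _) ?_)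
      rw [Module.finrank_fin_fun]
      omega
    obtain ⟨K, hK, hKA, hKB⟩ : ∃ K : Matrix (Fin d) (Fin d) ℝ, K * Kᵀ = 1 ∧
        (∀ k ∈ V.points A, ∀ l ∈ V.points A, q.col k - q.col l = K *ᵥ (p.col k - p.col l)) ∧
        (∀ k ∈ V.points B, ∀ l ∈ V.points B, q.col k - q.col l = K *ᵥ (p.col k - p.col l)) := by
      -- A side whose displacements stay in the overlap span has its matrix determined only up to
      -- reflection, so it adopts the matrix of the other side. Hence the common matrix need not
      -- equal the individual `R i`.
      by_cases hA' : diffSpan p (V.points A) ≤ diffSpan p (V.points A ∩ V.points B)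
      · exact ⟨N, hN, fun k hk l hl => (hMq k hk l hl).trans
          (hMN _ (hA' (sub_mem_diffSpan p hk hl))), hNq⟩
      by_cases hB' : diffSpan p (V.points B) ≤ diffSpan p (V.points A ∩ V.points B)
      · exact ⟨M, hM, hMq, fun k hk l hl => (hNq k hk l hl).trans
          (hMN _ (hB' (sub_mem_diffSpan p hk hl))).symm⟩
      have hMdet := hpq _ M hM (htop Set.inter_subset_left hA') hMq
      have hNdet := hpq _ N hN (htop Set.inter_subset_right hB') hNq
      have hone : Nᵀ * M = 1 := by
        refine eq_one_of_orthogonal ?_ ?_ h fun x hx =>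
          transpose_mul_mulVec_of_eq hN (hMN x hx)
        · rw [transpose_mul, transpose_transpose, Matrix.mul_assoc, ← Matrix.mul_assoc N, hN,
            Matrix.one_mul, mul_eq_one_comm.mp hM]
        · rw [det_mul, det_transpose, hMdet, hNdet, mul_one]
      have : M = N := by rw [← Matrix.one_mul M, ← hN, Matrix.mul_assoc, hone, Matrix.mul_one]
      exact ⟨M, hM, hMq, this ▸ hNq⟩
    obtain ⟨o, hoA, hoB⟩ := exists_mem_of_finrank hd h
    refine ⟨K, hK, ?_⟩
    have key : ∀ k ∈ V.points (A ∪ B), q.col k - q.col o = K *ᵥ (p.col k - p.col o) := by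
      rw [V.points_union]
      rintro k (hk | hk)
      exacts [hKA k hk o hoA, hKB k hk o hoB]
    intro k hk l hl
    rw [← sub_sub_sub_cancel_right _ _ (q.col o), key k hk, key l hl, ← mulVec_sub,
      sub_sub_sub_cancel_right]

theorem sum_realization (S : Alignment d m) (a : Fin d) : ∑ k, V.realization S a k = 0 := by
  rcases Nat.eq_zero_or_pos n with rfl | hn
  · simp
  have hn' : (n : ℝ) ≠ 0 := by positivity
  have h : ∀ k, V.realization S a k = (S.stackᵀ * V.B * V.lapPinv) a (.inl k) -
      (n : ℝ)⁻¹ * ∑ j, (S.stackᵀ * V.B * V.lapPinv) a (.inl j) := by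
    intro k
    rw [realization, Matrix.mul_sub, Matrix.mul_one, Matrix.sub_apply, Matrix.mul_smul,
      Matrix.smul_apply, Matrix.mul_apply]
    simp
  simp only [h, Finset.sum_sub_distrib, Finset.sum_const, Finset.card_univ, Fintype.card_fin,
    nsmul_eq_mul]
  rw [mul_inv_cancel_left₀ hn', sub_self]

/-- Summing the displacement identity over l gives n q_k = n M p_k, as both configurations are
centred. -/
theorem eq_mul_of_col_sub {p q : Matrix (Fin d) (Fin n) ℝ} (hp : ∀ a, ∑ k, p a k = 0)
    (hq : ∀ a, ∑ k, q a k = 0) {M : Matrix (Fin d) (Fin d) ℝ}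
    (h : ∀ k l, q.col k - q.col l = M *ᵥ (p.col k - p.col l)) : q = M * p := by
  ext a k
  have hn : (n : ℝ) ≠ 0 := by
    have := k.pos
    positivity
  have h1 : ∀ l, q a k - q a l = (M * p) a k - (M * p) a l := by
    intro l
    have := congrFun (h k l) a
    rw [mulVec_sub] at this
    exact this
  have h2 : ∑ l, (M * p) a l = 0 := by
    simp only [Matrix.mul_apply]
    rw [Finset.sum_comm]
    simp [← Finset.mul_sum, hp]
  have h3 := Finset.sum_congr (rfl : (Finset.univ : Finset (Fin n)) = _) fun l _ => h1 l
  simp only [Finset.sum_sub_distrib, hq, h2, Finset.sum_const, Finset.card_univ, Fintype.card_fin,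
    nsmul_eq_mul, sub_zero] at h3
  exact mul_left_cancel₀ hn h3

/-- In dimension at most one, nearby realizations agree up to translation. -/
theorem col_sub_eq_of_le_one (hΓ : V.graph.Connected) {p q : Matrix (Fin d) (Fin n) ℝ}
    (hd : d < 2) (hpq : NearRotations p q)
    {R : Fin m → Matrix (Fin d) (Fin d) ℝ} (hR : ∀ i, R i * (R i)ᵀ = 1)
    (hq : ∀ k l i, V.mem k i → V.mem l i → q.col k - q.col l = R i *ᵥ (p.col k - p.col l))
    (k l : Fin n) : q.col k - q.col l = p.col k - p.col l := by
  have hview : ∀ i k l, V.mem k i → V.mem l i → q.col k - p.col k = q.col l - p.col l := by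
    intro i k l hk hl
    rw [sub_eq_sub_iff_sub_eq_sub]
    -- In dimension at most one, the displacements of a view either span, and then `R i` has
    -- determinant 1 and is the identity, or all vanish.
    by_cases htop : diffSpan p {k | V.mem k i} = ⊤
    · have h1 := hpq _ (R i) (hR i) htop fun k hk l hl => hq k l i hk hl
      have h2 : R i = 1 := eq_one_of_orthogonal (H := ⊥) (mul_eq_one_comm.mp (hR i)) h1
        (by rw [finrank_bot]; omega)
        fun x hx => by rw [(Submodule.mem_bot ℝ).mp hx, mulVec_zero]
      rw [hq k l i hk hl, h2, one_mulVec]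
    · have h1 := Submodule.finrank_lt (lt_top_iff_ne_top.mpr htop).ne
      rw [Module.finrank_fin_fun] at h1
      have h2 : diffSpan p {k | V.mem k i} = ⊥ := by
        rw [← Submodule.finrank_eq_zero (R := ℝ)]
        omega
      have h3 : p.col k - p.col l = 0 := by
        rw [← Submodule.mem_bot ℝ, ← h2]
        exact sub_mem_diffSpan p hk hl
      rw [hq k l i hk hl, h3, mulVec_zero]
  -- The vector q_k - p_k is constant on each view, and this propagates along paths of Γ; at a view
  -- vertex the claim concerns all its points.
  have hreach : ∀ w, V.graph.Reachable (.inl l) w → match w with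
      | .inl k => q.col k - p.col k = q.col l - p.col l
      | .inr i => ∀ k, V.mem k i → q.col k - p.col k = q.col l - p.col l := by
    intro w hw
    rw [SimpleGraph.reachable_iff_reflTransGen] at hw
    induction hw with
    | refl => rfl
    | @tail b c _ hbc ih =>
      rcases b with b | b <;> rcases c with c | c
      · exact hbc.elim
      · exact fun k hk => (hview c k b hk hbc).trans ih
      · exact ih c hbc
      · exact hbc.elim
  rw [← sub_eq_sub_iff_sub_eq_sub]
  exact hreach (.inl k) (hΓ.preconnected _ _)

/-- The Frobenius norm dominates every entry, hence the sup distance that defines the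
neighbourhoods. -/
theorem exists_frobNorm_lt {p : Matrix (Fin d) (Fin n) ℝ} {P : Matrix (Fin d) (Fin n) ℝ → Prop}
    (h : ∀ᶠ q in nhds p, P q) : ∃ ε : ℝ, 0 < ε ∧ ∀ q, frobNorm (q - p) < ε → P q := by
  have h' : ∀ᶠ q : Fin d → Fin n → ℝ in nhds p, P q := h
  obtain ⟨ε, hε, hball⟩ := Metric.eventually_nhds_iff.mp h'
  refine ⟨ε, hε, fun q hq => hball ?_⟩
  refine (dist_pi_lt_iff hε).mpr fun a => (dist_pi_lt_iff hε).mpr fun k => lt_of_le_of_lt ?_ hq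
  rw [Real.dist_eq, frobNorm]
  refine Real.abs_le_sqrt ?_
  refine le_trans ?_ (Finset.single_le_sum (f := fun a => ∑ b, (q - p) a b ^ 2)
    (fun a _ => Finset.sum_nonneg fun b _ => sq_nonneg _) (Finset.mem_univ a))
  exact Finset.single_le_sum (f := fun b => (q - p) a b ^ 2) (fun b _ => sq_nonneg _)
    (Finset.mem_univ k)

theorem locallyRigid (hΓ : V.graph.Connected) {S : Alignment d m} (hS : V.IsPerfect S)
    (hG : graphOrder (V.reducedGraph S) = 1) : V.LocallyRigid S := by
  obtain ⟨ε, hε, hnear⟩ := exists_frobNorm_lt (eventually_nearRotations (V.realization S))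
  refine ⟨ε, hε, fun O hO hdist => ?_⟩
  have hpq := hnear _ hdist
  let R : Fin m → Matrix (Fin d) (Fin d) ℝ := fun i =>
    (O i : Matrix (Fin d) (Fin d) ℝ)ᵀ * (S i : Matrix (Fin d) (Fin d) ℝ)
  have hR : ∀ i, R i * (R i)ᵀ = 1 := fun i => by
    simp only [R]
    rw [transpose_mul, transpose_transpose, Matrix.mul_assoc, ← Matrix.mul_assoc (S i).1,
      mul_transpose_coe, Matrix.one_mul, transpose_mul_coe]
  have hq : ∀ k l i, V.mem k i → V.mem l i → (V.realization O).col k - (V.realization O).col l =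
      R i *ᵥ ((V.realization S).col k - (V.realization S).col l) := by
    intro k l i hk hl
    rw [V.realization_col_sub hS hk hl, V.realization_col_sub hO hk hl, mulVec_mulVec]
    simp only [R]
    rw [Matrix.mul_assoc, mul_transpose_coe, Matrix.mul_one]
  obtain ⟨M, hM, h⟩ : ∃ M : Matrix (Fin d) (Fin d) ℝ, M * Mᵀ = 1 ∧ ∀ k l,
      (V.realization O).col k - (V.realization O).col l =
        M *ᵥ ((V.realization S).col k - (V.realization S).col l) := by
    rcases Nat.lt_or_ge d 2 with hd | hd
    · refine ⟨1, by simp, fun k l => ?_⟩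
      rw [one_mulVec]
      exact V.col_sub_eq_of_le_one hΓ hd hpq hR hq k l
    · have hglued := V.glued_univ hG
      obtain ⟨M, hM, h⟩ := hglued.exists_orthogonal hd hpq hR hq
      -- There is at least one view, so a connected Γ has no isolated point and every point lies in
      -- some view.
      have hmem : ∀ k, k ∈ V.points Set.univ := by
        intro k
        obtain ⟨i⟩ : Nonempty (Fin m) := (Nat.card_eq_one_iff_unique.mp hG).2.map Quotient.out
        have hne : (Sum.inl k : Fin n ⊕ Fin m) ≠ .inr i := Sum.inl_ne_inr
        have : Nontrivial (Fin n ⊕ Fin m) := ⟨_, _, hne⟩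
        obtain ⟨w, hw⟩ :=
          SimpleGraph.Preconnected.exists_adj_of_nontrivial hΓ.preconnected (Sum.inl k)
        rcases w with w | w
        · exact hw.elim
        · exact ⟨w, trivial, hw⟩
      exact ⟨M, hM, fun k l => h k (hmem k) l (hmem l)⟩
  -- The transpose appears because right multiplication of S by Q multiplies the realization on the
  -- left by Qᵀ.
  refine ⟨⟨Mᵀ, (Matrix.mem_orthogonalGroup_iff' (Fin d) ℝ).mpr (by simpa using hM)⟩, ?_⟩
  rw [realization_rightMul]
  exact eq_mul_of_col_sub (V.sum_realization S) (V.sum_realization O) (by simpa using h)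

end ViewSystem
end RigidAlignment

theorem mainTheorem4 {d n m : ℕ} (V : RigidAlignment.ViewSystem d n m)
    (hΓ : V.graph.Connected)
    (S : RigidAlignment.Alignment d m) (hS : V.IsPerfect S)
    (hG : RigidAlignment.graphOrder (V.reducedGraph S) = 1) :
    V.IsNondegenerate (RigidAlignment.proj S) ∧ V.LocallyRigid S :=
  ⟨V.isNondegenerate hS hG, V.locallyRigid hΓ hS hG⟩
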